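/- For every real $\phi$ there is a constant $C=C(\phi)$ such that the following holds for every $n$. Let $K_n=(V,E)$ be the complete graph on $n$ vertices, and let $X=(X_e)_{e\in E}$ be independent real random variables with $|X_e|\le 1$ almost surely, each having a density with respect to Lebesgue measure that is bounded above by $\phi$. For $\sigma\in\{-1,1\}^V$ put $$\mathbf H(\sigma)=-\frac12\sum_{uv\in E}X_{uv}\,\sigma(u)\sigma(v).$$ An improving move from $\sigma$ is a configuration $\sigma'$ that differs from $\sigma$ at exactly one vertex and satisfies $\mathbf H(\sigma')>\mathbf H(\sigma)$. The FLIP algorithm starts at some configuration and repeatedly performs improving moves until it reaches a configuration that has no improving move; an implementation of FLIP is an arbitrary rule choosing the initial configuration and, at each step, one of the available improving moves (the choices may depend on all the weights, on the past of the run and on additional randomness). Then for every implementation of FLIP, the number $T$ of steps performed before termination satisfies $$\mathbb E[T]\le C\,n^{15}.$$ -/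

import Mathlib

open MeasureTheory ProbabilityTheory
open scoped NNReal ENNReal

namespace LocalMaxCut

/-- The edges of the complete graph on the vertex set `Fin n`. -/
abbrev Edge (n : ℕ) : Type := (⊤ : SimpleGraph (Fin n)).edgeSet

/-- Spin configurations `{-1, 1}^V`; `ℤˣ` is the two-element set `{1, -1}`. -/
abbrev Config (n : ℕ) : Type := Fin n → ℤˣ

/-- The product `σ(u) σ(v)` of the spins at the two endpoints of `e = uv`. -/
def spinProd {n : ℕ} (σ : Config n) (e : Sym2 (Fin n)) : ℤˣ :=
  Sym2.lift ⟨fun u v => σ u * σ v, fun u v => mul_comm (σ u) (σ v)⟩ e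

/-- The Hamiltonian `H(σ) = -(1/2) ∑_{uv ∈ E} w_{uv} σ(u) σ(v)` of the edge weights `w`. -/
noncomputable def hamiltonian {n : ℕ} (w : Edge n → ℝ) (σ : Config n) : ℝ :=
  -(1 / 2 : ℝ) * ∑ e : Edge n, w e * ((spinProd σ e.1 : ℤ) : ℝ)

/-- `σ'` is an improving move from `σ`: it differs from `σ` at exactly one vertex and has
a larger value of the Hamiltonian. -/
def IsImprovingMove {n : ℕ} (w : Edge n → ℝ) (σ σ' : Config n) : Prop :=
  hammingDist σ' σ = 1 ∧ hamiltonian w σ < hamiltonian w σ'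

/-- FLIP stops at `σ`: there is no improving move from `σ`. -/
def IsTerminal {n : ℕ} (w : Edge n → ℝ) (σ : Config n) : Prop :=
  ∀ σ' : Config n, ¬ IsImprovingMove w σ σ'

/-- An implementation of FLIP on the complete graph on `n` vertices: a rule choosing the
initial configuration, and, whenever there is an improving move from the current
configuration, choosing one of them. Both choices may depend on all edge weights `w` and on a
random seed `ω : Ω`; the choice of a move may also depend on the list `h` of all configurations
visited earlier (most recent first). The value of `next` at a configuration without improving
moves is irrelevant. -/
structure Implementation (n : ℕ) (Ω : Type*) where
  init : Ω → (Edge n → ℝ) → Config n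
  next : Ω → (Edge n → ℝ) → List (Config n) → Config n → Config n
  next_improving : ∀ (ω : Ω) (w : Edge n → ℝ) (h : List (Config n)) (σ : Config n),
    ¬ IsTerminal w σ → IsImprovingMove w σ (next ω w h σ)

namespace Implementation

variable {n : ℕ} {Ω : Type*}

/-- The list of earlier configurations and the current configuration after `t` steps. Only the
times `t` up to the first visit to a terminal configuration are meaningful. -/
def run (A : Implementation n Ω) (ω : Ω) (w : Edge n → ℝ) : ℕ → List (Config n) × Config n
  | 0 => ([], A.init ω w)
  | t + 1 => ((A.run ω w t).2 :: (A.run ω w t).1,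
      A.next ω w (A.run ω w t).1 (A.run ω w t).2)

/-- The number of steps performed before FLIP terminates: the first time at which the current
configuration has no improving move (and `⊤` if there is no such time). -/
noncomputable def steps (A : Implementation n Ω) (ω : Ω) (w : Edge n → ℝ) : ℕ∞ :=
  ⨅ (t : ℕ) (_ : IsTerminal w (A.run ω w t).2), (t : ℕ∞)

end Implementation

end LocalMaxCut

/-! Any 2n consecutive moves involve at most n vertices. A shortest block of moves with at least
twice as many moves as moving vertices has exactly 2s moves of s vertices (`exists_critical_block`).
Add the gains of two consecutive moves of one vertex: edges to vertices with equal spins at both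
times cancel, so the sum is a linear form in the weights, depending only on the moves and on the
starting spins of the moving vertices. At least s/4 of these forms are triangular, each with its own
edge whose coefficient is at least 1 in absolute value (`card_le_of_critical`,
`IsCritical.exists_triangular`). Hence r ≥ s/4 independent-like constraints hold with probability at
most (2Φε)^r (`measure_pi_abs_linear_le`). With (2n)^(2s) choices of moves and spins, a union bound
shows that a slow block exists with probability at most n(2n)^8·2Φε (`measure_slowWeights_le`).

Without slow blocks every 2n moves gain more than ε, while the Hamiltonian varies by at most n^2, so
fewer than about 2n^3/ε moves occur. Summation over n dyadic values of ε, after which the trivial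
bound 2^n takes over, gives an expectation of order n^13. -/

namespace LocalMaxCut

/-! ### Small-ball estimates for linear forms. -/

theorem lintegral_pi_le_of_section_le {E : Type*} [Fintype E] [DecidableEq E]
    (ν : E → Measure ℝ) [∀ e, SigmaFinite (ν e)] {f g : (E → ℝ) → ℝ≥0∞}
    (hf : Measurable f) (hg : Measurable g) (i : E)
    (h : ∀ x : E → ℝ, ∫⁻ t, f (Function.update x i t) ∂ν i
      ≤ ∫⁻ t, g (Function.update x i t) ∂ν i) :
    ∫⁻ x, f x ∂Measure.pi ν ≤ ∫⁻ x, g x ∂Measure.pi ν := by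
  rw [lintegral_eq_lmarginal_univ (μ := ν) (f := f) (fun _ => 0),
    lintegral_eq_lmarginal_univ (μ := ν) (f := g) (fun _ => 0),
    lmarginal_erase' _ hf (Finset.mem_univ i), lmarginal_erase' _ hg (Finset.mem_univ i)]
  exact lmarginal_mono h _

/-- A set of slope at least one in the coordinate has small one-dimensional sections. -/
theorem measure_abs_affine_le {ν : Measure ℝ} {Φ : ℝ≥0} (hν : ∀ S, ν S ≤ Φ * volume S)
    {c b ε : ℝ} (hc : 1 ≤ |c|) :
    ν {t | |c * t + b| ≤ ε} ≤ Φ * ENNReal.ofReal (2 * ε) := by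
  refine (hν _).trans ?_
  gcongr
  have hsub : {t : ℝ | |c * t + b| ≤ ε} ⊆ Metric.closedBall (-b / c) ε := by
    intro t ht
    have hc0 : c ≠ 0 := by
      rintro rfl
      norm_num at hc
    have h1 : c * t + b = c * (t - -b / c) := by field_simp; ring
    rw [Set.mem_ofPred_eq, h1, abs_mul] at ht
    rw [Metric.mem_closedBall, Real.dist_eq]
    nlinarith [abs_nonneg (t - -b / c)]
  exact (measure_mono hsub).trans_eq (Real.volume_closedBall _ _)

/-- Small-ball estimate for a triangular system of linear forms in independent variables. -/
theorem measure_pi_abs_linear_le {E ι : Type*} [Fintype E]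
    (ν : E → Measure ℝ) [∀ e, IsProbabilityMeasure (ν e)] {Φ : ℝ≥0}
    (hν : ∀ e S, ν e S ≤ Φ * volume S) (ε : ℝ) (F : Finset ι) (a : ι → E → ℝ) (e : ι → E)
    (ρ : ι → ℤ) (hdiag : ∀ i ∈ F, 1 ≤ |a i (e i)|)
    (htri : ∀ i ∈ F, ∀ j ∈ F, j ≠ i → ρ j ≤ ρ i → a j (e i) = 0) :
    Measure.pi ν {x | ∀ i ∈ F, |∑ f, a i f * x f| ≤ ε}
      ≤ (Φ * ENNReal.ofReal (2 * ε)) ^ F.card := by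
  classical
  have hmeas : ∀ F : Finset ι, MeasurableSet {x : E → ℝ | ∀ i ∈ F, |∑ f, a i f * x f| ≤ ε} := by
    intro F
    have : {x : E → ℝ | ∀ i ∈ F, |∑ f, a i f * x f| ≤ ε}
        = ⋂ i ∈ F, {x | |∑ f, a i f * x f| ≤ ε} := by ext; simp
    rw [this]
    exact Finset.measurableSet_biInter _ fun i _ => measurableSet_le (by fun_prop) (by fun_prop)
  -- The form of largest rank owns a coordinate that no other form involves; integrating over it
  -- first yields one factor.
  induction F using Finset.induction_on_max_value ρ with
  | empty => simp
  | insert m s hm hmax ih =>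
    have ih := ih (fun i hi => hdiag i (Finset.mem_insert_of_mem hi))
      (fun i hi j hj => htri i (Finset.mem_insert_of_mem hi) j (Finset.mem_insert_of_mem hj))
    rw [Finset.card_insert_of_notMem hm, pow_succ']
    set K : ℝ≥0∞ := Φ * ENNReal.ofReal (2 * ε)
    set A := {x : E → ℝ | ∀ i ∈ s, |∑ f, a i f * x f| ≤ ε} with hA
    set B := {x : E → ℝ | ∀ i ∈ insert m s, |∑ f, a i f * x f| ≤ ε} with hB
    have hupd : ∀ (i : ι) (x : E → ℝ) (t : ℝ), ∑ f, a i f * Function.update x (e m) t f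
        = a i (e m) * t + ∑ f, a i f * Function.update x (e m) 0 f := by
      intro i x t
      rw [← Finset.add_sum_erase _ _ (Finset.mem_univ (e m)),
        ← Finset.add_sum_erase (a := e m) _ (fun f => a i f * Function.update x (e m) 0 f)
          (Finset.mem_univ (e m))]
      simp only [Function.update_self, mul_zero, zero_add, add_right_inj]
      refine Finset.sum_congr rfl fun f hf => ?_
      rw [Function.update_of_ne (Finset.ne_of_mem_erase hf),
        Function.update_of_ne (Finset.ne_of_mem_erase hf)]
    have hAupd : ∀ (x : E → ℝ) (t : ℝ), Function.update x (e m) t ∈ A ↔ x ∈ A := by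
      intro x t
      refine forall₂_congr fun i hi => ?_
      have h0 : a i (e m) = 0 := htri m (Finset.mem_insert_self _ _) i
        (Finset.mem_insert_of_mem hi) (fun h => hm (h ▸ hi)) (hmax i hi)
      have h1 := hupd i x t
      have h2 := hupd i x (x (e m))
      rw [Function.update_eq_self] at h2
      rw [h1, h2, h0]
      simp
    calc Measure.pi ν B = ∫⁻ x, B.indicator 1 x ∂Measure.pi ν :=
          (lintegral_indicator_one (hmeas _)).symm
      _ ≤ ∫⁻ x, A.indicator (fun _ => K) x ∂Measure.pi ν := by
          refine lintegral_pi_le_of_section_le ν (measurable_one.indicator (hmeas _))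
            (measurable_const.indicator (hmeas _)) (e m) fun x => ?_
          by_cases hx : x ∈ A
          · have hR : ∀ t, A.indicator (fun _ => K) (Function.update x (e m) t) = K := fun t =>
              Set.indicator_of_mem ((hAupd x t).2 hx) _
            simp only [hR, lintegral_const, measure_univ, mul_one]
            refine le_trans ?_ (measure_abs_affine_le (hν (e m))
              (b := ∑ f, a m f * Function.update x (e m) 0 f)
              (hdiag m (Finset.mem_insert_self _ _)))
            rw [← lintegral_indicator_one (measurableSet_le (by fun_prop) (by fun_prop))]
            refine lintegral_mono fun t => ?_
            by_cases ht : Function.update x (e m) t ∈ B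
            · have h1 := ht m (Finset.mem_insert_self _ _)
              rw [hupd] at h1
              rw [Set.indicator_of_mem ht, Set.indicator_of_mem (by exact h1)]
              rfl
            · rw [Set.indicator_of_notMem ht]
              exact zero_le
          · have hL : ∀ t, B.indicator (1 : (E → ℝ) → ℝ≥0∞) (Function.update x (e m) t) = 0 :=
              fun t => Set.indicator_of_notMem (s := B) (fun h : _ ∈ B => hx ((hAupd x t).1
                fun i hi => h i (Finset.mem_insert_of_mem hi))) _
            simp [hL]
      _ = K * Measure.pi ν A := lintegral_indicator_const (hmeas _) _
      _ ≤ K * K ^ s.card := by gcongr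

/-! ### Combinatorics of move sequences. -/

section Sequences

variable {V : Type*} [DecidableEq V]

/-- `t < t'` are consecutive occurrences of the same vertex in the sequence `v`. -/
def IsReturn (v : ℕ → V) (t t' : ℕ) : Prop :=
  t < t' ∧ v t' = v t ∧ ∀ i, t < i → i < t' → v i ≠ v t

/-- The sign acquired by the spin of `u` when the vertices `v 0, …, v (t - 1)` are flipped. -/
def flipSign (v : ℕ → V) (t : ℕ) (u : V) : ℤˣ := (-1) ^ Nat.count (fun i => v i = u) t

/-- The first `2 * s` terms of `v` form a minimal block of moves in which the average number of
moves of a moving vertex is at least two; between consecutive moves of a vertex, some other vertex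
is moved an odd number of times. -/
structure IsCritical (v : ℕ → V) (s : ℕ) : Prop where
  card_eq : ((Finset.range (2 * s)).image v).card = s
  le_card : ∀ c d, c < d → d ≤ 2 * s → d - c ≤ 2 * ((Finset.Ico c d).image v).card
  exists_flip : ∀ t t', t' < 2 * s → IsReturn v t t' →
    ∃ u, u ≠ v t ∧ flipSign v t u ≠ flipSign v t' u

theorem units_ne_neg (x : ℤˣ) : x ≠ -x := by
  rcases Int.units_eq_one_or x with rfl | rfl <;> decide

theorem exists_isReturn {v : ℕ → V} {t t' : ℕ} (h : t < t') (hv : v t' = v t) :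
    ∃ r, r ≤ t' ∧ IsReturn v t r := by
  classical
  have hex : ∃ r, t < r ∧ v r = v t := ⟨t', h, hv⟩
  refine ⟨Nat.find hex, Nat.find_min' hex ⟨h, hv⟩, (Nat.find_spec hex).1, (Nat.find_spec hex).2,
    fun i hi hi' he => Nat.find_min hex hi' ⟨hi, he⟩⟩

theorem flipSign_eq_of_forall_ne {v : ℕ → V} {t t' : ℕ} {u : V} (h : t ≤ t')
    (hu : ∀ i, t ≤ i → i < t' → v i ≠ u) : flipSign v t u = flipSign v t' u := by
  obtain ⟨k, rfl⟩ := Nat.exists_eq_add_of_le h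
  have : Nat.count (fun i => v (t + i) = u) k = 0 :=
    Nat.count_iff_forall_not.2 fun m hm => hu _ (by omega) (by omega)
  simp only [flipSign]
  rw [Nat.count_add, this, add_zero]

theorem flipSign_succ_self (v : ℕ → V) (t : ℕ) : flipSign v (t + 1) (v t) = -flipSign v t (v t) := by
  simp [flipSign, Nat.count_succ, pow_succ]

theorem flipSign_succ_of_ne {v : ℕ → V} {t : ℕ} {u : V} (h : v t ≠ u) :
    flipSign v (t + 1) u = flipSign v t u := by
  simp [flipSign, Nat.count_succ, h]

theorem IsReturn.flipSign_eq {v : ℕ → V} {t t' : ℕ} (h : IsReturn v t t') :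
    flipSign v t' (v t) = -flipSign v t (v t) := by
  rw [← flipSign_succ_self, eq_comm]
  exact flipSign_eq_of_forall_ne h.1 fun i hi hi' => h.2.2 i hi hi'

theorem flipSign_ne_of_unique {v : ℕ → V} {t t' i : ℕ} (h : t ≤ i) (h' : i < t')
    (hu : ∀ j, t ≤ j → j < t' → v j = v i → j = i) :
    flipSign v t' (v i) ≠ flipSign v t (v i) := by
  have h1 : flipSign v t (v i) = flipSign v i (v i) :=
    flipSign_eq_of_forall_ne h fun j hj hj' he => by
      have := hu j hj (by omega) he
      omega
  have h2 : flipSign v (i + 1) (v i) = flipSign v t' (v i) :=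
    flipSign_eq_of_forall_ne h' fun j hj hj' he => by
      have := hu j (by omega) hj' he
      omega
  rw [h1, ← h2, flipSign_succ_self]
  exact fun h => units_ne_neg _ h.symm

/-- Combinatorial core: in a critical block one finds either many returns that enclose a vertex
moved only once in the block, or many vertices that are moved repeatedly. -/
theorem card_le_of_critical {v : ℕ → V} {s : ℕ}
    (hcard : ((Finset.range (2 * s)).image v).card = s)
    (hsub : ∀ c d, c < d → d ≤ 2 * s → d - c ≤ 2 * ((Finset.Ico c d).image v).card) :
    ∃ D R : Finset ℕ,
      (∀ t ∈ D, (∀ i < t, v i ≠ v t) ∧ ∃ t', t' < 2 * s ∧ IsReturn v t t') ∧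
      (∀ t ∈ R, ∃ t' i, t' < 2 * s ∧ IsReturn v t t' ∧ t < i ∧ i < t' ∧
        ∀ j < 2 * s, v j = v i → j = i) ∧
      s ≤ D.card + 2 * R.card := by
  classical
  set A := Finset.range (2 * s) with hA
  set fst := A.filter fun t => ∀ i < t, v i ≠ v t with hfst
  set lst := A.filter fun t => ∀ i ∈ A, t < i → v i ≠ v t with hlst
  have hfst_card : fst.card = s := by
    have h1 : fst.image v = A.image v := by
      refine Finset.Subset.antisymm (Finset.image_subset_image (Finset.filter_subset _ _)) ?_
      intro u hu
      obtain ⟨t, ht, rfl⟩ := Finset.mem_image.1 hu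
      have hex : ∃ r, v r = v t := ⟨t, rfl⟩
      refine Finset.mem_image.2 ⟨Nat.find hex, ?_, Nat.find_spec hex⟩
      have h2 := Nat.find_min' hex (m := t) rfl
      refine Finset.mem_filter.2 ⟨Finset.mem_range.2
        (lt_of_le_of_lt h2 (Finset.mem_range.1 ht)), fun i hi he => ?_⟩
      exact Nat.find_min hex hi (he.trans (Nat.find_spec hex))
    rw [← hcard, ← h1, Finset.card_image_of_injOn]
    intro a ha b hb hab
    simp only [hfst, Finset.coe_filter, Set.mem_ofPred_eq] at ha hb
    rcases lt_trichotomy a b with h | h | h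
    · exact absurd hab (hb.2 a h)
    · exact h
    · exact absurd hab.symm (ha.2 b h)
  have hlst_max : ∀ t ∈ A, ∃ r ∈ lst, v r = v t := by
    intro t ht
    have hne : (A.filter fun r => v r = v t).Nonempty := ⟨t, by simp [ht]⟩
    have hm := Finset.max'_mem _ hne
    set m := (A.filter fun r => v r = v t).max' hne
    rw [Finset.mem_filter] at hm
    refine ⟨m, Finset.mem_filter.2 ⟨hm.1, fun i hi hmi he => ?_⟩, hm.2⟩
    exact absurd (Finset.le_max' (A.filter fun r => v r = v t) i
      (Finset.mem_filter.2 ⟨hi, he.trans hm.2⟩)) (not_le.2 hmi)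
  have hlst_inj : Set.InjOn v lst := by
    intro a ha b hb hab
    simp only [hlst, Finset.coe_filter, Set.mem_ofPred_eq] at ha hb
    rcases lt_trichotomy a b with h | h | h
    · exact absurd hab.symm (ha.2 b hb.1 h)
    · exact h
    · exact absurd hab (hb.2 a ha.1 h)
  have hlst_card : lst.card = s := by
    rw [← hcard, ← Finset.card_image_of_injOn hlst_inj]
    congr 1
    refine Finset.Subset.antisymm (Finset.image_subset_image (Finset.filter_subset _ _)) ?_
    intro u hu
    obtain ⟨t, ht, rfl⟩ := Finset.mem_image.1 hu
    obtain ⟨r, hr, he⟩ := hlst_max t ht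
    exact Finset.mem_image.2 ⟨r, hr, he⟩
  set Sg := fst ∩ lst with hSg
  have hSg_uniq : ∀ i ∈ Sg, ∀ j < 2 * s, v j = v i → j = i := by
    intro i hi j hj he
    rw [hSg, Finset.mem_inter, hfst, hlst, Finset.mem_filter, Finset.mem_filter] at hi
    rcases lt_trichotomy j i with h | h | h
    · exact absurd he (hi.1.2 j h)
    · exact h
    · exact absurd he (hi.2.2 j (Finset.mem_range.2 hj) h)
  have hret : ∀ t ∈ A, t ∉ lst → ∃ t', t' < 2 * s ∧ IsReturn v t t' := by
    intro t ht htl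
    simp only [hlst, Finset.mem_filter, ht, true_and, not_forall, not_not] at htl
    obtain ⟨i, hi, hti, he⟩ := htl
    obtain ⟨r, hr, hR⟩ := exists_isReturn hti he
    exact ⟨r, lt_of_le_of_lt hr (Finset.mem_range.1 hi), hR⟩
  set N := A \ Sg with hN
  -- Moves of vertices that move only once cut the block into runs, numbered by `g`; `Q` counts the
  -- distinct vertices run by run.
  set g : ℕ → ℕ := fun t => Nat.count (fun i => i ∈ Sg) t with hg
  have hgmono : Monotone g := Nat.count_monotone _
  set R := A.filter fun t => ∃ t', t' < 2 * s ∧ IsReturn v t t' ∧ g t < g t' with hR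
  set Q := N.image fun t => (g t, v t) with hQ
  have hSgA : Sg ⊆ A := fun i hi =>
    (Finset.mem_filter.1 (Finset.mem_inter.1 hi).1).1
  have hNQ : N.card ≤ 2 * Q.card := by
    rw [Finset.card_eq_sum_card_image g N,
      Finset.card_eq_sum_card_fiberwise (s := Q) (f := Prod.fst) (t := N.image g)
        (by
          intro p hp
          obtain ⟨t, ht, rfl⟩ := Finset.mem_image.1 hp
          exact Finset.mem_image_of_mem g ht), Finset.mul_sum]
    refine Finset.sum_le_sum fun i hi => ?_
    set T := N.filter fun t => g t = i with hT
    have hTne : T.Nonempty := by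
      obtain ⟨t, ht, he⟩ := Finset.mem_image.1 hi
      exact ⟨t, Finset.mem_filter.2 ⟨ht, he⟩⟩
    have hmin := Finset.mem_filter.1 (Finset.min'_mem T hTne)
    have hmax := Finset.mem_filter.1 (Finset.max'_mem T hTne)
    have hle : T.min' hTne ≤ T.max' hTne := Finset.min'_le _ _ (Finset.max'_mem T hTne)
    set c := T.min' hTne with hc
    set d := T.max' hTne with hd
    have hdA := Finset.mem_range.1 (Finset.mem_sdiff.1 hmax.1).1
    -- Each run is an interval of times, so `hsub` applies to it.
    have hTI : T = Finset.Ico c (d + 1) := by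
      ext x
      rw [Finset.mem_Ico]
      constructor
      · intro hx
        exact ⟨Finset.min'_le _ _ hx, Nat.lt_succ_of_le (Finset.le_max' _ _ hx)⟩
      · rintro ⟨h1, h2⟩
        have hx2 : g x ≤ g d := hgmono (Nat.lt_succ_iff.1 h2)
        have hx1 : g c ≤ g x := hgmono h1
        refine Finset.mem_filter.2 ⟨Finset.mem_sdiff.2 ⟨Finset.mem_range.2 (by omega),
          fun hxS => ?_⟩, by omega⟩
        have hxd : x ≠ d := fun h => (Finset.mem_sdiff.1 hmax.1).2 (h ▸ hxS)
        have : g x < g d := Nat.count_strict_mono hxS (by omega)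
        omega
    have h1 := hsub c (d + 1) (by omega) (by omega)
    rw [← hTI] at h1
    have h2 : T.card = d + 1 - c := by rw [hTI, Nat.card_Ico]
    have h3 : (T.image v).card ≤ (Q.filter fun p => p.1 = i).card := by
      rw [← Finset.card_image_of_injective (T.image v) (Prod.mk_right_injective i)]
      refine Finset.card_le_card fun p hp => ?_
      obtain ⟨u, hu, rfl⟩ := Finset.mem_image.1 hp
      obtain ⟨t, ht, rfl⟩ := Finset.mem_image.1 hu
      rw [hT, Finset.mem_filter] at ht
      exact Finset.mem_filter.2 ⟨Finset.mem_image.2 ⟨t, ht.1, by rw [ht.2]⟩, rfl⟩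
    omega
  -- Take the last move of a vertex within a run: either it is its last move altogether, or its next
  -- move lies in a later run and the return encloses a once-moved vertex.
  have hQR : Q.card ≤ R.card + (lst \ fst).card := by
    have hsubset : Q ⊆ (R ∪ (lst \ fst)).image fun t => (g t, v t) := by
      intro p hp
      have hne : (N.filter fun t => (g t, v t) = p).Nonempty := by
        obtain ⟨t, ht, he⟩ := Finset.mem_image.1 hp
        exact ⟨t, Finset.mem_filter.2 ⟨ht, he⟩⟩
      have hm := Finset.mem_filter.1 (Finset.max'_mem _ hne)
      have hmax := Finset.le_max' (N.filter fun t => (g t, v t) = p)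
      set m := (N.filter fun t => (g t, v t) = p).max' hne
      refine Finset.mem_image.2 ⟨m, ?_, hm.2⟩
      have hmA := Finset.mem_sdiff.1 hm.1
      by_cases hml : m ∈ lst
      · exact Finset.mem_union_right _ (Finset.mem_sdiff.2
          ⟨hml, fun h => hmA.2 (Finset.mem_inter.2 ⟨h, hml⟩)⟩)
      · obtain ⟨t', ht', hr⟩ := hret m hmA.1 hml
        refine Finset.mem_union_left _ (Finset.mem_filter.2 ⟨hmA.1, t', ht', hr, ?_⟩)
        refine lt_of_le_of_ne (hgmono hr.1.le) fun he => ?_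
        have ht'N : t' ∈ N := by
          refine Finset.mem_sdiff.2 ⟨Finset.mem_range.2 ht', fun h => ?_⟩
          have := hSg_uniq t' h m (Finset.mem_range.1 hmA.1) hr.2.1.symm
          have := hr.1
          omega
        have := hmax t' (Finset.mem_filter.2 ⟨ht'N, by rw [← hm.2, ← he, hr.2.1]⟩)
        have := hr.1
        omega
    exact (Finset.card_le_card hsubset).trans (Finset.card_image_le.trans
      (Finset.card_union_le _ _))
  -- With d = |fst \ lst| = |lst \ fst| one has |N| = s + d, so s + d ≤ 2|Q| ≤ 2|R| + 2d.
  have h1 : (fst \ lst).card + Sg.card = s := by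
    rw [← hfst_card, hSg]; exact Finset.card_sdiff_add_card_inter _ _
  have h2 : (lst \ fst).card + Sg.card = s := by
    rw [← hlst_card, hSg, Finset.inter_comm]; exact Finset.card_sdiff_add_card_inter _ _
  have h3 : N.card + Sg.card = 2 * s := by
    rw [hN, Finset.card_sdiff_add_card_eq_card hSgA, hA, Finset.card_range]
  refine ⟨fst \ lst, R, fun t ht => ?_, fun t ht => ?_, by omega⟩
  · rw [Finset.mem_sdiff] at ht
    have ht1 := Finset.mem_filter.1 ht.1
    exact ⟨ht1.2, hret t ht1.1 ht.2⟩
  · obtain ⟨htA, t', ht', hr, hlt⟩ := Finset.mem_filter.1 ht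
    have hex : ∃ i, t ≤ i ∧ i < t' ∧ i ∈ Sg := by
      by_contra hcon
      push Not at hcon
      obtain ⟨k, rfl⟩ := Nat.exists_eq_add_of_le hr.1.le
      have h0 : Nat.count (fun i => t + i ∈ Sg) k = 0 :=
        Nat.count_iff_forall_not.2 fun m hm => hcon _ (by omega) (by omega)
      simp only [hg] at hlt
      rw [Nat.count_add, h0] at hlt
      omega
    obtain ⟨i, hi, hi', hiS⟩ := hex
    have huniq := hSg_uniq i hiS
    refine ⟨t', i, ht', hr, lt_of_le_of_ne hi ?_, hi', huniq⟩
    rintro rfl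
    have := huniq t' ht' hr.2.1
    have := hr.1
    omega

end Sequences

/-! ### Linear forms attached to returns. -/

variable {n : ℕ}

/-- The configuration obtained from `τ` by flipping `v 0, …, v (t - 1)` one after the other. -/
def flipConfig (τ : Config n) (v : ℕ → Fin n) (t : ℕ) : Config n := fun u => τ u * flipSign v t u

/-- The coefficient of the weight of `e` in the sum of the gains of the moves of the vertex
`v t` at the times `t` and `t'`. -/
def pairCoeff (τ : Config n) (v : ℕ → Fin n) (t t' : ℕ) (e : Edge n) : ℝ :=
  if v t ∈ e.1 then
    ((spinProd (flipConfig τ v t) e.1 : ℤ) : ℝ) + ((spinProd (flipConfig τ v t') e.1 : ℤ) : ℝ)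
  else 0

theorem spinProd_mk (σ : Config n) (a b : Fin n) : spinProd σ s(a, b) = σ a * σ b := rfl

theorem Edge.exists_eq_mk {e : Edge n} {a : Fin n} (h : a ∈ e.1) : ∃ b, b ≠ a ∧ e.1 = s(a, b) := by
  obtain ⟨b, hb⟩ := h
  refine ⟨b, ?_, hb⟩
  rintro rfl
  have h1 := e.2
  rw [hb, SimpleGraph.mem_edgeSet] at h1
  exact h1.ne rfl

theorem spinProd_flipConfig_of_isReturn {τ : Config n} {v : ℕ → Fin n} {t t' : ℕ}
    (h : IsReturn v t t') (u : Fin n) :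
    spinProd (flipConfig τ v t') s(v t, u)
      = -(τ (v t) * flipSign v t (v t) * (τ u * flipSign v t' u)) := by
  simp [spinProd_mk, flipConfig, h.flipSign_eq]

/-- The spin of `v t` is reversed between the two moves. If the other endpoint keeps its spin, the
two products cancel; if it is reversed too, they agree and add up to ±2, which is
`one_le_abs_pairCoeff`. -/
theorem pairCoeff_eq_zero {τ : Config n} {v : ℕ → Fin n} {t t' : ℕ} (h : IsReturn v t t')
    {e : Edge n} {u : Fin n} (he : e.1 = s(v t, u)) (hu : flipSign v t u = flipSign v t' u) :
    pairCoeff τ v t t' e = 0 := by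
  rw [pairCoeff, he, spinProd_flipConfig_of_isReturn h, spinProd_mk, ← hu]
  simp [flipConfig]

theorem one_le_abs_pairCoeff {τ : Config n} {v : ℕ → Fin n} {t t' : ℕ} (h : IsReturn v t t')
    {e : Edge n} {u : Fin n} (he : e.1 = s(v t, u)) (hu : flipSign v t u ≠ flipSign v t' u) :
    1 ≤ |pairCoeff τ v t t' e| := by
  have h1 : flipSign v t' u = -flipSign v t u := by
    rcases Int.units_eq_one_or (flipSign v t u) with h1 | h1 <;>
      rcases Int.units_eq_one_or (flipSign v t' u) with h2 | h2 <;> simp_all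
  rw [pairCoeff, he, spinProd_flipConfig_of_isReturn h, spinProd_mk, h1]
  simp only [flipConfig, mul_neg, neg_neg, Sym2.mem_iff, true_or, if_true]
  generalize τ (v t) * flipSign v t (v t) * (τ u * flipSign v t u) = x
  rcases Int.units_eq_one_or x with rfl | rfl <;> norm_num

/-- In a critical block there is a large triangular family of returns. -/
theorem IsCritical.exists_triangular {v : ℕ → Fin n} {s : ℕ} (hv : IsCritical v s) (hs : 1 ≤ s)
    (τ : Config n) :
    ∃ (F : Finset ℕ) (r : ℕ → ℕ) (e : ℕ → Edge n) (ρ : ℕ → ℤ), s ≤ 4 * F.card ∧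
      (∀ t ∈ F, r t < 2 * s ∧ IsReturn v t (r t) ∧ 1 ≤ |pairCoeff τ v t (r t) (e t)|) ∧
      ∀ i ∈ F, ∀ j ∈ F, j ≠ i → ρ j ≤ ρ i → pairCoeff τ v j (r j) (e i) = 0 := by
  obtain ⟨D, R, hD, hR, hDR⟩ := card_le_of_critical hv.card_eq hv.le_card
  have : Nonempty (Fin n) := ⟨v 0⟩
  have hD' : ∀ t ∈ D, ∃ r u, r < 2 * s ∧ IsReturn v t r ∧ u ≠ v t ∧
      flipSign v t u ≠ flipSign v r u := by
    intro t ht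
    obtain ⟨-, r, hr, hret⟩ := hD t ht
    obtain ⟨u, hu⟩ := hv.exists_flip t r hr hret
    exact ⟨r, u, hr, hret, hu⟩
  choose! r u hr hret hu hflip using hD'
  choose! r' i hr' hret' hi hi' huniq using hR
  have hine : ∀ t ∈ R, v (i t) ≠ v t := fun t ht => (hret' t ht).2.2 _ (hi t ht) (hi' t ht)
  have : Nonempty (Edge n) := by
    rcases D.eq_empty_or_nonempty with rfl | ⟨t, ht⟩
    · have : R.Nonempty := by
        rw [← Finset.card_pos]
        simp only [Finset.card_empty] at hDR
        omega
      obtain ⟨t, ht⟩ := this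
      exact ⟨⟨s(v (i t), v t), hine t ht⟩⟩
    · exact ⟨⟨s(u t, v t), hu t ht⟩⟩
  have he : ∀ t ∈ D, ∃ e : Edge n, e.1 = s(v t, u t) := fun t ht => ⟨⟨_, (hu t ht).symm⟩, rfl⟩
  have he' : ∀ t ∈ R, ∃ e : Edge n, e.1 = s(v t, v (i t)) :=
    fun t ht => ⟨⟨_, (hine t ht).symm⟩, rfl⟩
  choose! e he using he
  choose! e' he' using he'
  have hvinj : ∀ a ∈ D, ∀ b ∈ D, a ≠ b → v a ≠ v b := by
    intro a ha b hb hab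
    rcases lt_or_gt_of_ne hab with h | h
    · exact (hD b hb).1 a h
    · exact ((hD a ha).1 b h).symm
  have hsplit : (D.filter fun t => v t < u t).card + (D.filter fun t => u t < v t).card
      = D.card := by
    rw [← Finset.card_filter_add_card_filter_not (s := D) (fun t => v t < u t)]
    congr 2
    refine Finset.filter_congr fun t ht => ?_
    have := hu t ht
    omega
  have hcoeffD : ∀ a ∈ D, ∀ b ∈ D, b ≠ a → v b ≠ u a → pairCoeff τ v b (r b) (e a) = 0 := by
    intro a ha b hb hba hbu
    rw [pairCoeff, if_neg]
    rw [he a ha, Sym2.mem_iff]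
    exact not_or.2 ⟨hvinj b hb a ha hba, hbu⟩
  -- As s ≤ |D| + 2|R|, either |R| ≥ s/4 or |D| > s/2; in the latter case one of the two
  -- orientations of the edges keeps half of `D`.
  rcases le_or_gt s (4 * R.card) with h | h
  -- The constant rank demands a diagonal family: each return owns the edge to the once-moved vertex
  -- it encloses.
  · refine ⟨R, r', e', fun _ => 0, h, fun t ht => ⟨hr' t ht, hret' t ht,
      one_le_abs_pairCoeff (hret' t ht) (he' t ht) (Ne.symm ?_)⟩, fun a ha b hb hba _ => ?_⟩
    · exact flipSign_ne_of_unique (hi t ht).le (hi' t ht) fun j _ hj he =>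
        huniq t ht j (hj.trans (hr' t ht)) he
    · by_cases hbe : v b ∈ (e' a).1
      · have hb1 := (hret' b hb).1
        have hvb : v b = v a := by
          rw [he' a ha, Sym2.mem_iff] at hbe
          refine hbe.resolve_right fun hb2 => ?_
          have h1 := huniq a ha b (hb1.trans (hr' b hb)) hb2
          have h2 := huniq a ha (r' b) (hr' b hb) ((hret' b hb).2.1.trans hb2)
          omega
        refine pairCoeff_eq_zero (hret' b hb) (u := v (i a)) (by rw [he' a ha, hvb]) ?_
        refine flipSign_eq_of_forall_ne hb1.le fun j hj hj' hje => ?_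
        have hj2 := huniq a ha j (hj'.trans (hr' b hb)) hje
        have hia := hi a ha
        have hia' := hi' a ha
        -- Distinct returns of the same vertex cannot overlap, so they cannot enclose the same move.
        rcases lt_or_gt_of_ne hba with hlt | hlt
        · exact (hret' b hb).2.2 a hlt (by omega) hvb.symm
        · exact (hret' a ha).2.2 b hlt (by omega) hvb
      · rw [pairCoeff, if_neg hbe]
  · rcases le_or_gt s (4 * (D.filter fun t => v t < u t).card) with h1 | h1
    -- Ranking by the vertex works because `v b ≤ v a < u a` excludes `v b = u a`; the other
    -- orientation reverses the rank.
    · refine ⟨_, r, e, fun t => (v t : ℕ), h1, fun t ht => ?_, fun a ha b hb hba hρ => ?_⟩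
      · have ht := (Finset.mem_filter.1 ht).1
        exact ⟨hr t ht, hret t ht, one_le_abs_pairCoeff (hret t ht) (he t ht) (hflip t ht)⟩
      · rw [Finset.mem_filter] at ha hb
        refine hcoeffD a ha.1 b hb.1 hba ?_
        have hρ : ((v b : ℕ) : ℤ) ≤ (v a : ℕ) := hρ
        have := ha.2
        omega
    · refine ⟨D.filter fun t => u t < v t, r, e, fun t => -(v t : ℕ), by omega,
        fun t ht => ?_, fun a ha b hb hba hρ => ?_⟩
      · have ht := (Finset.mem_filter.1 ht).1
        exact ⟨hr t ht, hret t ht, one_le_abs_pairCoeff (hret t ht) (he t ht) (hflip t ht)⟩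
      · rw [Finset.mem_filter] at ha hb
        refine hcoeffD a ha.1 b hb.1 hba ?_
        have hρ : -((v b : ℕ) : ℤ) ≤ -((v a : ℕ) : ℤ) := hρ
        have := ha.2
        omega

/-! ### Slow and critical blocks. -/

/-- The weights for which all returns in the block `v`, started from `τ`, gain at most `ε`. -/
def slowEvent (v : ℕ → Fin n) (τ : Config n) (s : ℕ) (ε : ℝ) : Set (Edge n → ℝ) :=
  {w | IsCritical v s ∧ ∀ t t', t' < 2 * s → IsReturn v t t' →
    |∑ e, pairCoeff τ v t t' e * w e| ≤ ε}

theorem measure_slowEvent_le (ν : Edge n → Measure ℝ) [∀ e, IsProbabilityMeasure (ν e)] {Φ : ℝ≥0}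
    (hν : ∀ e S, ν e S ≤ Φ * volume S) (v : ℕ → Fin n) (τ : Config n) {s : ℕ} (hs : 1 ≤ s)
    (ε : ℝ) : ∃ r, s ≤ 4 * r ∧
      Measure.pi ν (slowEvent v τ s ε) ≤ (Φ * ENNReal.ofReal (2 * ε)) ^ r := by
  by_cases hv : IsCritical v s
  · obtain ⟨F, r, e, ρ, hF, hdiag, htri⟩ := hv.exists_triangular hs τ
    refine ⟨F.card, hF, le_trans (measure_mono ?_) (measure_pi_abs_linear_le ν hν ε F
      (fun t => pairCoeff τ v t (r t)) e ρ (fun t ht => (hdiag t ht).2.2) htri)⟩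
    exact fun w hw t ht => hw.2 t (r t) (hdiag t ht).1 (hdiag t ht).2.1
  · refine ⟨s, by omega, ?_⟩
    have : slowEvent v τ s ε = ∅ := Set.eq_empty_of_forall_notMem fun w hw => hv hw.1
    simp [this]

/-- Take a shortest window whose length is at least twice its number of distinct vertices; the whole
window of length 2n qualifies. Minimality gives the bound on subwindows. -/
theorem exists_critical_block (v : ℕ → Fin n) (hn : 1 ≤ n) :
    ∃ c s, 1 ≤ s ∧ s ≤ n ∧ c + 2 * s ≤ 2 * n ∧
      ((Finset.Ico c (c + 2 * s)).image v).card = s ∧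
      ∀ a b, a < b → c ≤ a → b ≤ c + 2 * s → b - a ≤ 2 * ((Finset.Ico a b).image v).card := by
  classical
  have hex : ∃ L, 1 ≤ L ∧ ∃ c, c + L ≤ 2 * n ∧
      2 * ((Finset.Ico c (c + L)).image v).card ≤ L := by
    refine ⟨2 * n, by omega, 0, by omega, ?_⟩
    have := Finset.card_le_univ ((Finset.Ico 0 (0 + 2 * n)).image v)
    rw [Fintype.card_fin] at this
    omega
  set L := Nat.find hex with hL
  obtain ⟨hL1, c, hcL, hcard⟩ := Nat.find_spec hex
  rw [← hL] at hL1 hcL hcard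
  have hmin : ∀ a b, a < b → b ≤ 2 * n → b - a < L →
      b - a < 2 * ((Finset.Ico a b).image v).card := by
    intro a b hab hb hlt
    by_contra hcon
    refine Nat.find_min hex hlt ⟨by omega, a, by omega, ?_⟩
    rw [Nat.add_sub_cancel' hab.le]
    omega
  have heq : 2 * ((Finset.Ico c (c + L)).image v).card = L := by
    refine le_antisymm hcard ?_
    rcases Nat.eq_or_lt_of_le hL1 with h1 | h1
    · have : 0 < ((Finset.Ico c (c + L)).image v).card :=
        Finset.card_pos.2 ⟨v c, Finset.mem_image_of_mem v (by simp; omega)⟩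
      omega
    -- Dropping the last move must break the inequality, which forces equality for the full window.
    · have h2 := hmin c (c + L - 1) (by omega) (by omega) (by omega)
      have h3 : ((Finset.Ico c (c + L - 1)).image v).card
          ≤ ((Finset.Ico c (c + L)).image v).card :=
        Finset.card_le_card (Finset.image_subset_image
          (Finset.Ico_subset_Ico le_rfl (by omega)))
      omega
  refine ⟨c, ((Finset.Ico c (c + L)).image v).card, by omega, by omega, by omega, by rw [heq], ?_⟩
  rw [heq]
  intro a b hab ha hb
  rcases lt_or_ge (b - a) L with h | h
  · exact (hmin a b hab (by omega) h).le
  · obtain rfl : a = c := by omega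
    obtain rfl : b = a + L := by omega
    omega

/-! ### From FLIP moves to slow weights. -/

/-- `σ'` arises from `σ` by flipping the spin of `a`. -/
def IsFlip (σ σ' : Config n) (a : Fin n) : Prop := ∀ u, σ' u = if u = a then -σ u else σ u

theorem IsImprovingMove.exists_isFlip {w : Edge n → ℝ} {σ σ' : Config n}
    (h : IsImprovingMove w σ σ') : ∃ a, IsFlip σ σ' a := by
  obtain ⟨a, ha⟩ := Finset.card_eq_one.1 (show _ = 1 from h.1)
  refine ⟨a, fun u => ?_⟩
  have h1 : σ' u ≠ σ u ↔ u = a := by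
    have := Finset.ext_iff.1 ha u
    simpa using this
  split_ifs with hu
  · have h2 := h1.2 hu
    rcases Int.units_eq_one_or (σ u) with h3 | h3 <;>
      rcases Int.units_eq_one_or (σ' u) with h4 | h4 <;> simp_all
  · exact not_not.1 (mt h1.1 hu)

theorem IsFlip.hamiltonian_sub {σ σ' : Config n} {a : Fin n} (h : IsFlip σ σ' a)
    (w : Edge n → ℝ) : hamiltonian w σ' - hamiltonian w σ
      = ∑ e : Edge n, if a ∈ e.1 then w e * ((spinProd σ e.1 : ℤ) : ℝ) else 0 := by
  simp only [hamiltonian]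
  rw [← mul_sub, ← Finset.sum_sub_distrib, Finset.mul_sum]
  refine Finset.sum_congr rfl fun e _ => ?_
  split_ifs with ha
  · obtain ⟨b, hb, he⟩ := Edge.exists_eq_mk ha
    have : spinProd σ' e.1 = -spinProd σ e.1 := by
      rw [he, spinProd_mk, spinProd_mk, h a, h b, if_pos rfl, if_neg hb, neg_mul]
    rw [this]
    push_cast
    ring
  · have : spinProd σ' e.1 = spinProd σ e.1 := by
      obtain ⟨e, he⟩ := e
      induction e with
      | h x y =>
        rw [Sym2.mem_iff, not_or] at ha
        rw [spinProd_mk, spinProd_mk, h x, h y, if_neg (Ne.symm ha.1), if_neg (Ne.symm ha.2)]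
    rw [this]
    ring

theorem eq_flipConfig {σ : ℕ → Config n} {v : ℕ → Fin n} {L : ℕ}
    (h : ∀ t < L, IsFlip (σ t) (σ (t + 1)) (v t)) :
    ∀ t ≤ L, σ t = flipConfig (σ 0) v t := by
  intro t
  induction t with
  | zero => intro _; funext u; simp [flipConfig, flipSign]
  | succ t ih =>
    intro ht
    funext u
    rw [h t (by omega) u, ih (by omega)]
    split_ifs with hu
    · subst hu
      simp [flipConfig, flipSign_succ_self]
    · simp [flipConfig, flipSign_succ_of_ne (Ne.symm hu)]

/-- Edges to vertices that never move contribute nothing, so their spins are irrelevant. The union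
bound thus ranges over at most 2^(2s) sign patterns instead of 2^n. -/
theorem pairCoeff_congr {τ τ' : Config n} {v : ℕ → Fin n} {t t' L : ℕ} (h : IsReturn v t t')
    (ht' : t' < L) (hτ : ∀ i < L, τ (v i) = τ' (v i)) (e : Edge n) :
    pairCoeff τ v t t' e = pairCoeff τ' v t t' e := by
  by_cases hm : v t ∈ e.1
  · obtain ⟨u, -, he⟩ := Edge.exists_eq_mk hm
    by_cases hu : ∃ i < L, v i = u
    · obtain ⟨i, hi, rfl⟩ := hu
      have h1 := hτ t (h.1.trans ht')
      have h2 := hτ i hi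
      simp only [pairCoeff, he, spinProd_mk, flipConfig, h1, h2]
    · push Not at hu
      have hflip : flipSign v t u = flipSign v t' u :=
        flipSign_eq_of_forall_ne h.1.le fun i _ hi => hu i (hi.trans ht')
      rw [pairCoeff_eq_zero h he hflip, pairCoeff_eq_zero h he hflip]
  · simp [pairCoeff, hm]

/-- A finite sequence of vertices continued by a constant. -/
def extendSeq [NeZero n] {m : ℕ} (q : Fin m → Fin n) (i : ℕ) : Fin n :=
  if h : i < m then q ⟨i, h⟩ else 0

/-- The weights for which some critical block gains at most `ε`. -/
def slowWeights (n : ℕ) [NeZero n] (ε : ℝ) : Set (Edge n → ℝ) :=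
  ⋃ s ∈ Finset.Icc 1 n, ⋃ q : Fin (2 * s) → Fin n, ⋃ ρ : Fin (2 * s) → ℤˣ,
    slowEvent (extendSeq q) (Function.extend q ρ 1) s ε

/-- All gains are positive, so any two of them together are at most the total gain. -/
theorem mem_slowWeights [NeZero n] {w : Edge n → ℝ} {σ : ℕ → Config n} {ε : ℝ}
    (himp : ∀ t < 2 * n, IsImprovingMove w (σ t) (σ (t + 1)))
    (hε : hamiltonian w (σ (2 * n)) - hamiltonian w (σ 0) ≤ ε) : w ∈ slowWeights n ε := by
  have hmono : ∀ i j, i ≤ j → j ≤ 2 * n → hamiltonian w (σ i) ≤ hamiltonian w (σ j) := by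
    intro i j hij
    induction j, hij using Nat.le_induction with
    | base => intro _; exact le_rfl
    | succ j _ ih => intro hj; exact (ih (by omega)).trans (himp j (by omega)).2.le
  have hflip : ∀ t, ∃ a, t < 2 * n → IsFlip (σ t) (σ (t + 1)) a := by
    intro t
    by_cases ht : t < 2 * n
    · obtain ⟨a, ha⟩ := (himp t ht).exists_isFlip
      exact ⟨a, fun _ => ha⟩
    · exact ⟨0, fun h => absurd h ht⟩
  choose v hv using hflip
  obtain ⟨c, s, hs1, hsn, hcs, hcard, hle⟩ := exists_critical_block v (NeZero.one_le (n := n))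
  set q : Fin (2 * s) → Fin n := fun i => v (c + i) with hq
  set σ' : ℕ → Config n := fun t => σ (c + t) with hσ'
  set v' := extendSeq q with hv'
  have hvv : ∀ i < 2 * s, v' i = v (c + i) := by
    intro i hi
    simp [hv', extendSeq, hi, hq]
  have himg : ∀ a b, b ≤ 2 * s →
      (Finset.Ico a b).image v' = (Finset.Ico (c + a) (c + b)).image v := by
    intro a b hb
    rw [← Finset.image_add_left_Ico, Finset.image_image]
    refine Finset.image_congr fun i hi => ?_
    have := (Finset.mem_Ico.1 (Finset.mem_coe.1 hi)).2
    exact hvv i (by omega)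
  have hstep : ∀ t < 2 * s, IsFlip (σ' t) (σ' (t + 1)) (v' t) := by
    intro t ht
    rw [hvv t ht]
    exact hv (c + t) (by omega)
  have hconf := eq_flipConfig hstep
  have hgain : ∀ t t', t' < 2 * s → IsReturn v' t t' →
      ∑ e, pairCoeff (σ' 0) v' t t' e * w e
        = (hamiltonian w (σ' (t + 1)) - hamiltonian w (σ' t))
          + (hamiltonian w (σ' (t' + 1)) - hamiltonian w (σ' t')) := by
    intro t t' ht' hr
    have := hr.1
    rw [(hstep t (by omega)).hamiltonian_sub, (hstep t' ht').hamiltonian_sub,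
      ← Finset.sum_add_distrib, hr.2.1, hconf t (by omega), hconf t' (by omega)]
    refine Finset.sum_congr rfl fun e _ => ?_
    rw [pairCoeff]
    split_ifs <;> ring
  have hcrit : IsCritical v' s := by
    refine ⟨?_, fun a b hab hb => ?_, fun t t' ht' hr => ?_⟩
    · rw [Finset.range_eq_Ico, himg 0 _ le_rfl]
      exact hcard
    · rw [himg a b hb]
      have := hle (c + a) (c + b) (by omega) (by omega) (by omega)
      omega
    · have hlt := hr.1
      -- A positive total gain needs a nonzero coefficient, hence another vertex whose spin changed
      -- in between.
      have hpos : 0 < ∑ e, pairCoeff (σ' 0) v' t t' e * w e := by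
        rw [hgain t t' ht' hr]
        have h1 := (himp (c + t) (by omega)).2
        have h2 := (himp (c + t') (by omega)).2
        exact add_pos (sub_pos.2 h1) (sub_pos.2 h2)
      obtain ⟨e, -, he⟩ := Finset.exists_ne_zero_of_sum_ne_zero hpos.ne'
      have he := left_ne_zero_of_mul he
      have hm : v' t ∈ e.1 := by
        by_contra hm
        exact he (by rw [pairCoeff, if_neg hm])
      obtain ⟨u, hu, heu⟩ := Edge.exists_eq_mk hm
      exact ⟨u, hu, fun h => he (pairCoeff_eq_zero hr heu h)⟩
  simp only [slowWeights, Set.mem_iUnion]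
  -- The signs are read off the true configuration at the start of the block; the default 1 affects
  -- only vertices that do not move.
  refine ⟨s, Finset.mem_Icc.2 ⟨hs1, hsn⟩, q, fun i => σ' 0 (q i), hcrit, fun t t' ht' hr => ?_⟩
  have hext : ∀ i < 2 * s, Function.extend q (fun i => σ' 0 (q i)) 1 (v' i) = σ' 0 (v' i) := by
    intro i hi
    have h1 : v' i = q ⟨i, hi⟩ := by simp [hv', extendSeq, hi]
    have hfac : Function.FactorsThrough (fun i => σ' 0 (q i)) q := fun a b hab => by
      simp only [hab]
    rw [h1, hfac.extend_apply]
  simp only [pairCoeff_congr hr ht' hext]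
  rw [hgain t t' ht' hr]
  have hlt := hr.1
  have h1 := (himp (c + t) (by omega)).2
  have h2 := (himp (c + t') (by omega)).2
  have h3 := hmono 0 (c + t) (by omega) (by omega)
  have h4 := hmono (c + t + 1) (c + t') (by omega) (by omega)
  have h5 := hmono (c + t' + 1) (2 * n) (by omega) (by omega)
  simp only [hσ', ← add_assoc]
  rw [abs_of_nonneg (by linarith)]
  linarith

theorem abs_hamiltonian_le {w : Edge n → ℝ} (hw : ∀ e, |w e| ≤ 1) (σ : Config n) :
    |hamiltonian w σ| ≤ (n : ℝ) ^ 2 / 2 := by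
  have h1 : |∑ e : Edge n, w e * ((spinProd σ e.1 : ℤ) : ℝ)| ≤ (Fintype.card (Edge n) : ℝ) := by
    refine (Finset.abs_sum_le_sum_abs _ _).trans ?_
    refine (Finset.sum_le_card_nsmul _ _ 1 fun e _ => ?_).trans (by simp)
    rw [abs_mul]
    rcases Int.units_eq_one_or (spinProd σ e.1) with h | h <;> simpa [h] using hw e
  have h2 : Fintype.card (Edge n) ≤ n ^ 2 := by
    rw [← SimpleGraph.edgeFinset_card, SimpleGraph.card_edgeFinset_top_eq_card_choose_two,
      Fintype.card_fin]
    exact Nat.choose_le_pow n 2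
  have h3 : (Fintype.card (Edge n) : ℝ) ≤ (n : ℝ) ^ 2 := by exact_mod_cast h2
  rw [hamiltonian, abs_mul]
  norm_num
  linarith

/-! ### Bounds on the number of steps. -/

namespace Implementation

variable {Ω : Type*}

theorem steps_le {A : Implementation n Ω} {ω : Ω} {w : Edge n → ℝ} {t K : ℕ}
    (ht : IsTerminal w (A.run ω w t).2) (htK : t ≤ K) : A.steps ω w ≤ K :=
  (iInf₂_le t ht).trans (by exact_mod_cast htK)

theorem isImprovingMove_run {A : Implementation n Ω} {ω : Ω} {w : Edge n → ℝ} {t : ℕ}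
    (ht : ¬ IsTerminal w (A.run ω w t).2) :
    IsImprovingMove w (A.run ω w t).2 (A.run ω w (t + 1)).2 :=
  A.next_improving ω w _ _ ht

/-- The Hamiltonian strictly increases, so no configuration is visited twice. -/
theorem steps_le_two_pow (A : Implementation n Ω) (ω : Ω) (w : Edge n → ℝ) :
    A.steps ω w ≤ ((2 ^ n : ℕ) : ℕ∞) := by
  by_contra hcon
  have hnt : ∀ t ≤ 2 ^ n, ¬ IsTerminal w (A.run ω w t).2 :=
    fun t ht h => hcon (steps_le h ht)
  have hmono : ∀ i j, i < j → j ≤ 2 ^ n →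
      hamiltonian w (A.run ω w i).2 < hamiltonian w (A.run ω w j).2 := by
    intro i j hij
    induction j, hij using Nat.le_induction with
    | base => intro hj; exact (isImprovingMove_run (hnt i (by omega))).2
    | succ j _ ih =>
      intro hj
      exact (ih (by omega)).trans (isImprovingMove_run (hnt j (by omega))).2
  have hinj : Function.Injective fun i : Fin (2 ^ n + 1) => (A.run ω w i).2 := by
    intro i j hij
    have hij : (A.run ω w i).2 = (A.run ω w j).2 := hij
    rcases lt_trichotomy (i : ℕ) j with h | h | h
    · exact absurd (hmono i j h (by omega)) (by rw [hij]; exact lt_irrefl _)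
    · exact Fin.ext h
    · exact absurd (hmono j i h (by omega)) (by rw [hij]; exact lt_irrefl _)
  have := Fintype.card_le_of_injective _ hinj
  simp at this

theorem steps_le_of_notMem_slowWeights [NeZero n] (A : Implementation n Ω) (ω : Ω)
    {w : Edge n → ℝ} (hw : ∀ e, |w e| ≤ 1) {N : ℕ} (hN : 1 ≤ N)
    (hslow : w ∉ slowWeights n (1 / N)) : A.steps ω w ≤ ((2 * n ^ 3 * N : ℕ) : ℕ∞) := by
  by_contra hcon
  have hnt : ∀ t ≤ 2 * n ^ 3 * N, ¬ IsTerminal w (A.run ω w t).2 :=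
    fun t ht h => hcon (steps_le h ht)
  have hn : 1 ≤ n := NeZero.one_le
  -- Strictness is recorded for m > 0, since n^2·N blocks must gain strictly more than the full
  -- range n^2.
  have hgain : ∀ m, m ≤ n ^ 2 * N → (m : ℝ) * (1 / N)
      ≤ hamiltonian w (A.run ω w (2 * n * m)).2 - hamiltonian w (A.run ω w 0).2 ∧
      (0 < m → (m : ℝ) * (1 / N)
      < hamiltonian w (A.run ω w (2 * n * m)).2 - hamiltonian w (A.run ω w 0).2) := by
    intro m
    induction m with
    | zero => intro _; simp
    | succ m ih =>
      intro hm
      have hle : 2 * n * m + 2 * n ≤ 2 * n ^ 3 * N := by nlinarith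
      have h1 := (ih (by omega)).1
      have h2 : 1 / (N : ℝ) < hamiltonian w (A.run ω w (2 * n * m + 2 * n)).2
          - hamiltonian w (A.run ω w (2 * n * m)).2 := by
        by_contra hcon2
        exact hslow (mem_slowWeights (σ := fun t => (A.run ω w (2 * n * m + t)).2)
          (fun t ht => isImprovingMove_run (hnt _ (by omega))) (not_lt.1 hcon2))
      have h3 : ((m + 1 : ℕ) : ℝ) * (1 / N)
          < hamiltonian w (A.run ω w (2 * n * (m + 1))).2 - hamiltonian w (A.run ω w 0).2 := by
        rw [mul_add, mul_one]
        push_cast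
        linarith
      exact ⟨h3.le, fun _ => h3⟩
  have h1 := (hgain (n ^ 2 * N) le_rfl).2 (by positivity)
  have h2 := abs_le.1 (abs_hamiltonian_le hw (A.run ω w (2 * n * (n ^ 2 * N))).2)
  have h3 := abs_le.1 (abs_hamiltonian_le hw (A.run ω w 0).2)
  have h4 : ((n ^ 2 * N : ℕ) : ℝ) * (1 / N) = (n : ℝ) ^ 2 := by
    have : (N : ℝ) ≠ 0 := by positivity
    push_cast
    field_simp
  linarith

end Implementation

/-! ### Union bound and expectation. -/

theorem measure_slowWeights_le [NeZero n] (ν : Edge n → Measure ℝ)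
    [∀ e, IsProbabilityMeasure (ν e)] {Φ : ℝ≥0} (hν : ∀ e S, ν e S ≤ Φ * volume S) (ε : ℝ)
    (hε : (2 * n : ℝ≥0∞) ^ 8 * (Φ * ENNReal.ofReal (2 * ε)) ≤ 1) :
    Measure.pi ν (slowWeights n ε)
      ≤ n * ((2 * n : ℝ≥0∞) ^ 8 * (Φ * ENNReal.ofReal (2 * ε))) := by
  set K := Φ * ENNReal.ofReal (2 * ε)
  have hn1 : (1 : ℝ≥0∞) ≤ 2 * n := by
    have : 1 ≤ 2 * n := by have := NeZero.one_le (n := n); omega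
    exact_mod_cast this
  calc Measure.pi ν (slowWeights n ε)
      ≤ ∑ s ∈ Finset.Icc 1 n, (2 * n : ℝ≥0∞) ^ 8 * K := by
        refine (measure_biUnion_finset_le _ _).trans (Finset.sum_le_sum fun s hs => ?_)
        have hs1 := (Finset.mem_Icc.1 hs).1
        calc _ ≤ ∑ q : Fin (2 * s) → Fin n, ∑ ρ : Fin (2 * s) → ℤˣ, Measure.pi ν
                (slowEvent (extendSeq q) (Function.extend q ρ 1) s ε) :=
              (measure_iUnion_fintype_le _ _).trans
                (Finset.sum_le_sum fun q _ => measure_iUnion_fintype_le _ _)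
          -- The exponent depends on `q` and `ρ`; the supremum makes the bound uniform.
          _ ≤ ∑ q : Fin (2 * s) → Fin n, ∑ ρ : Fin (2 * s) → ℤˣ,
                ⨆ (r : ℕ) (_ : s ≤ 4 * r), K ^ r := by
              gcongr with q _ ρ _
              obtain ⟨r, hr, hle⟩ := measure_slowEvent_le ν hν (extendSeq q)
                (Function.extend q ρ 1) hs1 ε
              exact hle.trans (le_iSup₂_of_le r hr le_rfl)
          _ = (2 * n : ℝ≥0∞) ^ (2 * s) * ⨆ (r : ℕ) (_ : s ≤ 4 * r), K ^ r := by
              simp only [Finset.sum_const, Finset.card_univ, Fintype.card_fun, Fintype.card_fin,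
                Fintype.card_units_int, nsmul_eq_mul, mul_pow]
              push_cast
              ring
          _ ≤ (2 * n : ℝ≥0∞) ^ 8 * K := by
              simp only [ENNReal.mul_iSup]
              refine iSup₂_le fun r hr => ?_
              -- From s ≤ 4r comes 2s ≤ 8r, giving a pure r-th power of a number at most 1, with r ≥
              -- 1.
              calc (2 * n : ℝ≥0∞) ^ (2 * s) * K ^ r ≤ (2 * n : ℝ≥0∞) ^ (8 * r) * K ^ r := by
                    gcongr ?_ * _
                    exact pow_le_pow_right₀ hn1 (by omega)
                _ = ((2 * n : ℝ≥0∞) ^ 8 * K) ^ r := by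
                    rw [pow_mul (2 * n : ℝ≥0∞), ← mul_pow]
                _ ≤ _ := pow_le_of_le_one zero_le hε (by omega)
    _ = _ := by simp

theorem exists_nat_forall_measure_map_le {φ : ℝ} : ∃ Φ : ℕ, 1 ≤ Φ ∧ ∀ {Ω : Type*}
    [MeasurableSpace Ω] (μ : Measure Ω) (Y : Ω → ℝ), HasPDF Y μ volume →
    (∀ᵐ x : ℝ, pdf Y μ volume x ≤ ENNReal.ofReal φ) →
    ∀ S, μ.map Y S ≤ (Φ : ℝ≥0) * volume S := by
  -- The summand 1 keeps the bound positive for every real φ.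
  refine ⟨⌈φ⌉₊ + 1, by omega, fun {Ω} _ μ Y hY hφ S => ?_⟩
  have h1 : μ.map Y ≤ ENNReal.ofReal φ • volume := by
    rw [map_eq_withDensity_pdf Y μ volume, ← withDensity_const]
    exact withDensity_mono hφ
  refine (h1 S).trans ?_
  rw [Measure.smul_apply, smul_eq_mul]
  gcongr
  refine ENNReal.ofReal_le_of_le_toReal ?_
  simp only [Nat.cast_add, Nat.cast_one, ENNReal.coe_add, ENNReal.coe_natCast, ENNReal.coe_one]
  rw [ENNReal.toReal_add (by simp) (by simp)]
  simp only [ENNReal.toReal_natCast, ENNReal.toReal_one]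
  linarith [Nat.le_ceil φ]

/-- Stop at the first level k that is not slow, or at k = n, where 2^n suffices. For k > 0 the
resulting bound is charged to the slow level k - 1. -/
theorem Implementation.steps_le_sum [NeZero n] {Ω : Type*} (A : Implementation n Ω) (ω : Ω)
    {w : Edge n → ℝ} (hw : ∀ e, |w e| ≤ 1) {M : ℕ} (hM : 1 ≤ M) :
    (A.steps ω w : ℝ≥0∞) ≤ (2 * n ^ 3 * M : ℕ) + ∑ k ∈ Finset.range n,
      (slowWeights n (1 / (M * 2 ^ k : ℕ))).indicator
        (fun _ => ((2 * n ^ 3 * (M * 2 ^ (k + 1)) : ℕ) : ℝ≥0∞)) w := by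
  classical
  have hn : 1 ≤ n := NeZero.one_le
  have hcast : ∀ K : ℕ, A.steps ω w ≤ K → (A.steps ω w : ℝ≥0∞) ≤ (K : ℕ) := fun K hK => by
    exact_mod_cast ENat.toENNReal_le.2 hK
  have hex : ∃ k, n ≤ k ∨ w ∉ slowWeights n (1 / (M * 2 ^ k : ℕ)) := ⟨n, Or.inl le_rfl⟩
  have hspec := Nat.find_spec hex
  have hmin : ∀ k < Nat.find hex, k < n ∧ w ∈ slowWeights n (1 / (M * 2 ^ k : ℕ)) := by
    intro k hk
    have := Nat.find_min hex hk
    push Not at this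
    exact this
  set k := Nat.find hex
  have hle : A.steps ω w ≤ ((2 * n ^ 3 * (M * 2 ^ k) : ℕ) : ℕ∞) := by
    rcases hspec with h | h
    · refine (A.steps_le_two_pow ω w).trans ?_
      have h1 : 2 ^ n ≤ 2 ^ k := Nat.pow_le_pow_right (by norm_num) h
      have h2 : 0 < 2 * n ^ 3 * M := by positivity
      have h3 : 2 ^ n ≤ 2 * n ^ 3 * (M * 2 ^ k) := by
        rw [← mul_assoc]
        exact h1.trans (Nat.le_mul_of_pos_left _ h2)
      exact_mod_cast h3
    · exact A.steps_le_of_notMem_slowWeights ω hw (Nat.mul_pos hM (by positivity)) h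
  refine (hcast _ hle).trans ?_
  rcases Nat.eq_zero_or_pos k with h0 | h0
  · rw [h0, pow_zero, mul_one]
    exact le_self_add
  · obtain ⟨hlt, hmem⟩ := hmin (k - 1) (by omega)
    refine le_add_left ?_
    refine le_trans ?_ (Finset.single_le_sum (fun _ _ => zero_le) (Finset.mem_range.2 hlt))
    rw [Set.indicator_of_mem hmem, Nat.sub_add_cancel h0]

theorem lintegral_steps_le [NeZero n] {Ω : Type*} [MeasurableSpace Ω] (μ : Measure Ω)
    [IsProbabilityMeasure μ] {X : Edge n → Ω → ℝ} (hX : ∀ e, Measurable (X e))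
    (hind : iIndepFun X μ) (hbdd : ∀ e, ∀ᵐ ω ∂μ, |X e ω| ≤ 1) {Φ : ℕ} (hΦ : 1 ≤ Φ)
    (hpdf : ∀ e S, μ.map (X e) S ≤ (Φ : ℝ≥0) * volume S) (A : Implementation n Ω) :
    ∫⁻ ω, (A.steps ω (fun e => X e ω) : ℝ≥0∞) ∂μ ≤ (3072 * Φ * n ^ 13 : ℕ) := by
  have hn : 1 ≤ n := NeZero.one_le
  -- This makes (2n)^8·Φ·2ε equal to 2^(-k) for ε = 1/(M·2^k).
  set M := 2 * Φ * (2 * n) ^ 8 with hM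
  have hM1 : 1 ≤ M := Nat.mul_pos (by omega) (by positivity)
  set ν : Edge n → Measure ℝ := fun e => μ.map (X e) with hν
  have : ∀ e, IsProbabilityMeasure (ν e) :=
    fun e => Measure.isProbabilityMeasure_map (hX e).aemeasurable
  have hXm : Measurable fun ω e => X e ω := measurable_pi_lambda _ hX
  have hpi : μ.map (fun ω e => X e ω) = Measure.pi ν :=
    (iIndepFun_iff_map_fun_eq_pi_map fun e => (hX e).aemeasurable).1 hind
  -- Measurable hulls give a measurable majorant that can be transported to the product measure; the
  -- step count itself need not be measurable.
  set B : ℕ → Set (Edge n → ℝ) :=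
    fun k => toMeasurable (Measure.pi ν) (slowWeights n (1 / (M * 2 ^ k : ℕ))) with hB
  have hBm : ∀ k, MeasurableSet (B k) := fun k => measurableSet_toMeasurable _ _
  have hBle : ∀ k, Measure.pi ν (B k) * 2 ^ k ≤ n := by
    intro k
    have h1 : (2 * n : ℝ≥0∞) ^ 8 * (((Φ : ℝ≥0) : ℝ≥0∞) *
        ENNReal.ofReal (2 * (1 / (M * 2 ^ k : ℕ)))) = ENNReal.ofReal ((1 / 2) ^ k) := by
      have h2 : ((2 * n : ℕ) : ℝ≥0∞) ^ 8 * (Φ : ℝ≥0∞)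
          = ENNReal.ofReal ((2 * n : ℕ) ^ 8 * Φ) := by
        rw [ENNReal.ofReal_mul (by positivity), ENNReal.ofReal_pow (by positivity),
          ENNReal.ofReal_natCast, ENNReal.ofReal_natCast]
      push_cast at h2
      rw [ENNReal.coe_natCast, ← mul_assoc, h2, ← ENNReal.ofReal_mul (by positivity)]
      congr 1
      have : (Φ : ℝ) ≠ 0 := by positivity
      have : (n : ℝ) ≠ 0 := by positivity
      rw [hM]
      push_cast
      rw [div_pow, one_pow]
      field_simp
    have h3 := measure_slowWeights_le ν hpdf (1 / (M * 2 ^ k : ℕ)) (by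
      rw [h1]
      exact ENNReal.ofReal_le_one.2 (pow_le_one₀ (by norm_num) (by norm_num)))
    rw [h1] at h3
    rw [hB, measure_toMeasurable]
    refine (mul_le_mul_left h3 _).trans_eq ?_
    have h4 : (2 : ℝ≥0∞) ^ k = ENNReal.ofReal (2 ^ k) := by
      rw [ENNReal.ofReal_pow (by norm_num)]; norm_num
    rw [h4, mul_assoc, ← ENNReal.ofReal_mul (by positivity), ← mul_pow]
    norm_num
  have hae : ∀ᵐ ω ∂μ, ∀ e, |X e ω| ≤ 1 := ae_all_iff.2 hbdd
  calc ∫⁻ ω, (A.steps ω (fun e => X e ω) : ℝ≥0∞) ∂μ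
      ≤ ∫⁻ ω, ((2 * n ^ 3 * M : ℕ) + ∑ k ∈ Finset.range n, (B k).indicator
          (fun _ => ((2 * n ^ 3 * (M * 2 ^ (k + 1)) : ℕ) : ℝ≥0∞)) (fun e => X e ω)) ∂μ := by
        refine lintegral_mono_ae ?_
        filter_upwards [hae] with ω hω
        refine (A.steps_le_sum ω hω hM1).trans ?_
        gcongr with k _
        exact subset_toMeasurable _ _
    _ = ∫⁻ w, ((2 * n ^ 3 * M : ℕ) + ∑ k ∈ Finset.range n, (B k).indicator
          (fun _ => ((2 * n ^ 3 * (M * 2 ^ (k + 1)) : ℕ) : ℝ≥0∞)) w) ∂Measure.pi ν := by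
        rw [← hpi, lintegral_map _ hXm]
        refine Measurable.const_add ?_ _
        exact Finset.measurable_sum _ fun k _ => measurable_const.indicator (hBm k)
    _ = (2 * n ^ 3 * M : ℕ) + ∑ k ∈ Finset.range n,
          ((2 * n ^ 3 * (M * 2 ^ (k + 1)) : ℕ) : ℝ≥0∞) * Measure.pi ν (B k) := by
        rw [lintegral_add_left measurable_const, lintegral_finsetSum _ fun k _ =>
          measurable_const.indicator (hBm k)]
        simp [lintegral_indicator_const (hBm _)]
    _ ≤ (2 * n ^ 3 * M : ℕ) + ∑ k ∈ Finset.range n, ((4 * n ^ 4 * M : ℕ) : ℝ≥0∞) := by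
        gcongr with k _
        -- The factor 2^k in the step bound cancels the decay of the probability, so all n levels
        -- contribute equally.
        calc ((2 * n ^ 3 * (M * 2 ^ (k + 1)) : ℕ) : ℝ≥0∞) * Measure.pi ν (B k)
            = ((4 * n ^ 3 * M : ℕ) : ℝ≥0∞) * (Measure.pi ν (B k) * 2 ^ k) := by
              push_cast; ring
          _ ≤ ((4 * n ^ 3 * M : ℕ) : ℝ≥0∞) * n := by gcongr; exact hBle k
          _ = _ := by push_cast; ring
    _ = ((2 * n ^ 3 * M + n * (4 * n ^ 4 * M) : ℕ) : ℝ≥0∞) := by simp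
    _ ≤ (3072 * Φ * n ^ 13 : ℕ) := by
        refine Nat.cast_le.2 ?_
        have h1 : n ^ 3 ≤ n ^ 5 := Nat.pow_le_pow_right hn (by norm_num)
        calc 2 * n ^ 3 * M + n * (4 * n ^ 4 * M) ≤ 2 * n ^ 5 * M + n * (4 * n ^ 4 * M) := by gcongr
          _ = 3072 * Φ * n ^ 13 := by rw [hM]; ring

theorem Implementation.steps_eq_zero_of_fin_zero {Ω : Type*} (A : Implementation 0 Ω) (ω : Ω)
    (w : Edge 0 → ℝ) : A.steps ω w = 0 := by
  refine le_antisymm ((steps_le (t := 0) (K := 0) ?_ le_rfl).trans_eq (by simp)) zero_le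
  rintro σ' ⟨h, -⟩
  simp [Subsingleton.elim σ' (A.run ω w 0).2] at h

end LocalMaxCut

theorem corollaryC (φ : ℝ) :
    ∃ C : ℝ≥0, ∀ (n : ℕ) (Ω : Type*) [MeasurableSpace Ω] (μ : Measure Ω) [IsProbabilityMeasure μ]
      (X : LocalMaxCut.Edge n → Ω → ℝ),
      (∀ e, Measurable (X e)) →
      iIndepFun X μ →
      (∀ e, ∀ᵐ ω ∂μ, |X e ω| ≤ 1) →
      (∀ e, HasPDF (X e) μ volume ∧ ∀ᵐ x : ℝ, pdf (X e) μ volume x ≤ ENNReal.ofReal φ) →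
      ∀ A : LocalMaxCut.Implementation n Ω,
        ∫⁻ ω, (A.steps ω (fun e => X e ω) : ℝ≥0∞) ∂μ ≤ (C : ℝ≥0∞) * (n : ℝ≥0∞) ^ 15 := by
  obtain ⟨Φ, hΦ, hpdf⟩ := LocalMaxCut.exists_nat_forall_measure_map_le (φ := φ)
  refine ⟨(3072 * Φ : ℕ), fun n Ω _ μ _ X hX hind hbdd hdens A => ?_⟩
  rcases Nat.eq_zero_or_pos n with rfl | hn
  · simp [LocalMaxCut.Implementation.steps_eq_zero_of_fin_zero]
  · have : NeZero n := ⟨hn.ne'⟩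
    refine (LocalMaxCut.lintegral_steps_le μ hX hind hbdd hΦ
      (fun e => hpdf μ (X e) (hdens e).1 (hdens e).2) A).trans ?_
    have h1 : 3072 * Φ * n ^ 13 ≤ 3072 * Φ * n ^ 15 :=
      Nat.mul_le_mul_left _ (Nat.pow_le_pow_right hn (by norm_num))
    exact_mod_cast h1
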